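/- For $k \ge 2$ let $H$ be the $k$-uniform simplex, i.e. the hypergraph on $[k+1]$ whose edges $e_1,\dots,e_{k+1}$ are all the $k$-element subsets of $[k+1]$. A rooting of $H$ is an ordering $R = ((e_1,v_1),\dots,(e_{k+1},v_{k+1}))$ of its edges together with roots $v_i \in e_i$ such that $v_1 \le \dots \le v_{k+1}$; its digraph $D_R$ is the union, with multiplicities, of the stars $\{v_i u : u \in e_i,\ u \ne v_i\}$. Let $$C_H = \sum_{R} \frac{\tau_{D_R}}{\prod_{v} \deg^-_{D_R}(v)},$$ where the sum is over the rootings $R$ for which $D_R$ is Eulerian, and $\tau_D$ is the number of spanning arborescences of $D$ with a specified root (any choice of root is allowed). Let $C_k = (k-1)^k\, C_H$ be the simplex constant. Then $C_k$ equals $(k+1)!\,k^{k+1}$ up to a lower-order factor, which is asymptotically $1/(e k^3)$: as $k \to \infty$, $$C_k \sim \frac{(k+1)!\,k^{k+1}}{e\,k^{3}}.$$ In particular $C_k = \exp\big((2+o(1))\, k\log k\big)$; that is, there is a sequence $\varepsilon_k \to 0$ with $C_k = \exp((2+\varepsilon_k)\,k \log k)$ for all $k\ge 2$. -/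

import Mathlib

open Filter Topology Asymptotics

open scoped Nat

namespace SimplexConstant

noncomputable section

/-- A multi-digraph on the vertex set `V`, given by its arc multiplicities:
`D u v` is the number of arcs from `u` to `v`. -/
abbrev MultiDigraph (V : Type) : Type := V → V → ℕ

namespace MultiDigraph

variable {V : Type} [Fintype V]

/-- The out-degree of `v`, counted with multiplicity. -/
def outDegree (D : MultiDigraph V) (v : V) : ℕ := ∑ u, D v u

/-- The in-degree of `v`, counted with multiplicity. -/
def inDegree (D : MultiDigraph V) (v : V) : ℕ := ∑ u, D u v

/-- A multi-digraph is Eulerian if every vertex has equal in-degree and out-degree, and any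
vertex incident to an arc can be reached from any other such vertex along arcs. -/
def IsEulerian (D : MultiDigraph V) : Prop :=
  (∀ v, D.inDegree v = D.outDegree v) ∧
    ∀ u v, 0 < D.outDegree u → 0 < D.outDegree v →
      Relation.ReflTransGen (fun a b => 0 < D a b) u v

/-- A set `T` of ordered pairs is a spanning arborescence rooted at `r`: no arc enters `r`,
exactly one arc enters every other vertex, and every vertex is reachable from `r`. -/
def IsArborescence (r : V) (T : Finset (V × V)) : Prop :=
  (∀ u, (u, r) ∉ T) ∧ (∀ v, v ≠ r → ∃! u, (u, v) ∈ T) ∧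
    ∀ v, Relation.ReflTransGen (fun a b => (a, b) ∈ T) r v

open scoped Classical in
/-- The number of spanning arborescences of `D` rooted at `r`, parallel arcs being
distinguished. -/
def numArborescences (D : MultiDigraph V) (r : V) : ℕ :=
  ∑ T : Finset (V × V) with IsArborescence r T, ∏ a ∈ T, D a.1 a.2

end MultiDigraph

variable {V : Type} [Fintype V] [LinearOrder V]

/-- A rooting of the multi-hypergraph with edge multiset `E`: an ordering
`(e₁, v₁), …, (eₘ, vₘ)` of its edges, each with a chosen root `vᵢ ∈ eᵢ`, such that
`v₁ ≤ v₂ ≤ ⋯ ≤ vₘ`. -/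
def IsRooting (E : Multiset (Finset V)) (R : Fin E.card → Finset V × V) : Prop :=
  Multiset.map (fun i => (R i).1) Finset.univ.val = E ∧
    (∀ i, (R i).2 ∈ (R i).1) ∧ Monotone fun i => (R i).2

/-- The rooted multi-digraph of a sequence of pairs (edge, root): the union, with multiplicities,
of the stars having an arc from the root of each edge to each other vertex of that edge. -/
def rootedDigraph {m : ℕ} (R : Fin m → Finset V × V) : MultiDigraph V :=
  fun u v => ∑ i, if (R i).2 = u ∧ v ∈ (R i).1 ∧ u ≠ v then 1 else 0

open scoped Classical in
/-- The associated coefficient of the (connected Veblen) multi-hypergraph on `V` with edge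
multiset `E`: the sum, over all rootings whose digraph `D` is Eulerian, of the number of
arborescences of `D` with the specified root `r`, divided by the product of the in-degrees. -/
def associatedCoeff (E : Multiset (Finset V)) (r : V) : ℝ :=
  ∑ R : Fin E.card → Finset V × V with IsRooting E R ∧ (rootedDigraph R).IsEulerian,
    ((rootedDigraph R).numArborescences r : ℝ) / ∏ v, ((rootedDigraph R).inDegree v : ℝ)

/-- The edges of the `k`-uniform simplex: all `k`-element subsets of the `k + 1` vertices. -/
def simplexEdges (k : ℕ) : Multiset (Finset (Fin (k + 1))) :=
  (Finset.powersetCard k Finset.univ).val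

/-- The simplex constant `C_k = (k - 1) ^ k * C_H`, where `C_H` is the associated coefficient of
the `k`-uniform simplex `H`; `r` is the root at which arborescences are counted. -/
def simplexConstant (k : ℕ) (r : Fin (k + 1)) : ℝ :=
  ((k : ℝ) - 1) ^ k * associatedCoeff (simplexEdges k) r

end

end SimplexConstant

/-!
In a rooting of the simplex, a vertex that is the root of `d` edges has out-degree `d * (k - 1)` and
in-degree `k - d`, so an Eulerian digraph forces `d = 1` at every vertex. Since the edges are the
complements of single vertices, the Eulerian rootings correspond to the derangements `g` of the
`k + 1` vertices: the edge with root `i` is the complement of `g i`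
(`exists_eq_permRooting`, `isEulerian_permRooting`). All in-degrees are then `k - 1`, and the
Laplacian is `k I + P - J`, with `P` the permutation matrix of `g⁻¹` and `J` the all-ones matrix.
The matrix-tree theorem for directed multigraphs (`numArborescences_eq_det`) and a computation of
cofactors (`det_eq_card_sq_mul_det_updateRow`) give `(k + 1) ^ 2 * τ = det (k I + P)`, hence
`C_k = (∑ g, det (k I + P)) / ((k - 1) * (k + 1) ^ 2)` (`simplexConstant_eq`).

As `g` has no fixed point, `P` has trace zero, and its eigenvalues have norm at most one, so
`det (k I + P) = k ^ (k + 1) * exp O(1 / k)` uniformly in `g`: the first-order terms of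
`∑ log (1 + μ / k)` over the eigenvalues `μ` cancel
(`exists_det_scalar_add_permMatrix_eq_pow_mul_exp`). The number of derangements is asymptotic to
`(k + 1)! / e`, which gives the first claim. The second follows by taking logarithms and using
`log k! = k * log k + O(k)`.
-/

open Matrix SimplexConstant MultiDigraph

/-! ### The matrix-tree theorem for directed multigraphs -/

section MatrixTree

variable {V : Type} [Fintype V] [DecidableEq V]

/-- For a parent function `p` and a root `r`, the matrix whose row at `v ≠ r` is `e_v - e_{p v}` and
whose row at `r` is `e_r`. -/
def parentMatrix (r : V) (p : V → V) : Matrix V V ℝ :=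
  fun v => if v = r then Pi.single r 1 else Pi.single v 1 - Pi.single (p v) 1

theorem parentMatrix_mulVec (r : V) (p : V → V) (x : V → ℝ) (v : V) :
    (parentMatrix r p *ᵥ x) v = if v = r then x r else x v - x (p v) := by
  change parentMatrix r p v ⬝ᵥ x = _
  unfold parentMatrix
  split_ifs with h <;> simp [sub_dotProduct]

theorem det_parentMatrix_of_forall_reach {r : V} {p : V → V} (h : ∀ v, ∃ n, p^[n] v = r) :
    (parentMatrix r p).det = 1 := by
  classical
  -- Off the diagonal, row `v` is supported at the parent of `v`, whose depth is smaller.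
  let d : V → ℕ := fun v => Nat.find (h v)
  have hd : ∀ v, v ≠ r → d (p v) < d v := by
    intro v hv
    have h1 : p^[d v] v = r := Nat.find_spec (h v)
    obtain ⟨m, hm⟩ : ∃ m, d v = m + 1 :=
      Nat.exists_eq_succ_of_ne_zero fun h0 => hv (by simpa [h0] using h1)
    rw [hm, Function.iterate_succ_apply] at h1
    have : d (p v) ≤ m := Nat.find_min' (h (p v)) h1
    omega
  have key : ∀ v u, d v ≤ d u → parentMatrix r p v u = if v = u then 1 else 0 := by
    intro v u hvu
    unfold parentMatrix
    split_ifs with h1 h2 h2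
    · simp [← h1, h2]
    · subst h1; simp [Ne.symm h2]
    · subst h2
      have : p v ≠ v := fun h3 => by have := hd v h1; rw [h3] at this; omega
      simp [this.symm]
    · have : u ≠ p v := fun h3 => by have := hd v h1; rw [← h3] at this; omega
      simp [this, Ne.symm h2]
  have hT : BlockTriangular (parentMatrix r p) (fun v => OrderDual.toDual (d v)) := by
    intro v u hvu
    have hlt : d v < d u := hvu
    rw [key v u hlt.le, if_neg]
    rintro rfl
    exact lt_irrefl _ hlt
  rw [hT.det]
  refine Finset.prod_eq_one fun a _ => ?_
  have : toSquareBlock (parentMatrix r p) (fun v => OrderDual.toDual (d v)) a = 1 := by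
    ext ⟨v, hv⟩ ⟨u, hu⟩
    have hvu : d v = d u := OrderDual.toDual.injective (hv.trans hu.symm)
    simp [toSquareBlock_def, key v u hvu.le, one_apply]
  rw [this, det_one]

theorem det_parentMatrix_of_not_reach {r : V} {p : V → V} (h : ¬ ∀ v, ∃ n, p^[n] v = r) :
    (parentMatrix r p).det = 0 := by
  classical
  push Not at h
  obtain ⟨v₀, hv₀⟩ := h
  -- The indicator of the vertices that never reach `r` is in the kernel.
  refine exists_mulVec_eq_zero_iff.1 ⟨fun v => if ∃ n, p^[n] v = r then 0 else 1, ?_, ?_⟩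
  · intro h0
    have := congrFun h0 v₀
    simp [hv₀] at this
  · ext v
    rw [parentMatrix_mulVec]
    by_cases h1 : v = r
    · rw [if_pos h1, if_pos ⟨0, rfl⟩]; rfl
    · have hiff : (∃ n, p^[n] v = r) ↔ ∃ n, p^[n] (p v) = r := by
        constructor
        · rintro ⟨n, hn⟩
          obtain ⟨m, rfl⟩ : ∃ m, n = m + 1 :=
            Nat.exists_eq_succ_of_ne_zero fun h0 => h1 (by simpa [h0] using hn)
          exact ⟨m, hn⟩
        · rintro ⟨n, hn⟩; exact ⟨n + 1, hn⟩
      rw [if_neg h1]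
      simp [hiff]

/-- The arcs `(p v, v)`, for `v ≠ r`, of a parent function `p`. -/
def parentArcs (r : V) (p : V → V) : Finset (V × V) :=
  (Finset.univ.erase r).image fun v => (p v, v)

theorem mem_parentArcs {r : V} {p : V → V} {u v : V} :
    (u, v) ∈ parentArcs r p ↔ v ≠ r ∧ p v = u := by
  unfold parentArcs
  simp only [Finset.mem_image, Finset.mem_erase, Finset.mem_univ, and_true, Prod.mk.injEq]
  constructor
  · rintro ⟨a, ha, rfl, rfl⟩; exact ⟨ha, rfl⟩
  · rintro ⟨h, rfl⟩; exact ⟨v, h, rfl, rfl⟩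

theorem isArborescence_parentArcs_iff {r : V} {p : V → V} (hp : p r = r) :
    IsArborescence r (parentArcs r p) ↔ ∀ v, ∃ n, p^[n] v = r := by
  constructor
  · rintro ⟨-, -, h⟩ v
    induction h v with
    | refl => exact ⟨0, rfl⟩
    | tail _ hab ih =>
      obtain ⟨n, hn⟩ := ih
      obtain ⟨-, rfl⟩ := mem_parentArcs.1 hab
      exact ⟨n + 1, hn⟩
  · intro h
    refine ⟨fun u hu => (mem_parentArcs.1 hu).1 rfl,
      fun v hv => ⟨p v, mem_parentArcs.2 ⟨hv, rfl⟩, fun u hu => (mem_parentArcs.1 hu).2.symm⟩, ?_⟩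
    intro v
    obtain ⟨n, hn⟩ := h v
    induction n generalizing v with
    | zero => obtain rfl : v = r := hn; exact .refl
    | succ n ih =>
      by_cases hv : v = r
      · subst hv; exact .refl
      · exact (ih (p v) hn).tail (mem_parentArcs.2 ⟨hv, rfl⟩)

theorem exists_eq_parentArcs {r : V} {T : Finset (V × V)} (hT : IsArborescence r T) :
    ∃ p : V → V, p r = r ∧ parentArcs r p = T := by
  classical
  obtain ⟨h1, h2, -⟩ := hT
  choose! q hq using fun v hv => (h2 v hv).exists
  refine ⟨fun v => if v = r then r else q v, by simp, ?_⟩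
  ext ⟨u, v⟩
  rw [mem_parentArcs]
  constructor
  · rintro ⟨hv, rfl⟩
    simpa [hv] using hq v hv
  · intro huv
    have hv : v ≠ r := by rintro rfl; exact h1 _ huv
    exact ⟨hv, by simpa [hv] using (h2 v hv).unique (hq v hv) huv⟩

theorem parentArcs_injOn (r : V) : Set.InjOn (parentArcs r) {p : V → V | p r = r} := by
  intro p hp q hq h
  ext v
  by_cases hv : v = r
  · subst hv; exact hp.trans hq.symm
  · have : (p v, v) ∈ parentArcs r q := h ▸ mem_parentArcs.2 ⟨hv, rfl⟩
    exact (mem_parentArcs.1 this).2.symm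

theorem prod_parentArcs (r : V) (p : V → V) (D : MultiDigraph V) :
    ∏ a ∈ parentArcs r p, D a.1 a.2 = ∏ v ∈ Finset.univ.erase r, D (p v) v := by
  unfold parentArcs
  rw [Finset.prod_image]
  intro a _ b _ hab
  exact (Prod.mk.inj hab).2

open scoped Classical in
/-- A spanning arborescence is the same thing as a parent function `p`, normalized by `p r = r`,
whose iterates take every vertex to the root `r`. -/
theorem numArborescences_eq_sum_parent (D : MultiDigraph V) (r : V) :
    D.numArborescences r =
      ∑ p : V → V with p r = r ∧ ∀ v, ∃ n, p^[n] v = r,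
        ∏ v ∈ Finset.univ.erase r, D (p v) v := by
  unfold numArborescences
  symm
  refine Finset.sum_bij (fun p _ => parentArcs r p) ?_ ?_ ?_ ?_
  · intro p hp
    obtain ⟨h1, h2⟩ := (Finset.mem_filter.1 hp).2
    exact Finset.mem_filter.2 ⟨Finset.mem_univ _, (isArborescence_parentArcs_iff h1).2 h2⟩
  · intro p hp q hq h
    exact parentArcs_injOn r (Finset.mem_filter.1 hp).2.1 (Finset.mem_filter.1 hq).2.1 h
  · intro T hT
    obtain ⟨p, hp, rfl⟩ := exists_eq_parentArcs (Finset.mem_filter.1 hT).2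
    exact ⟨p, Finset.mem_filter.2 ⟨Finset.mem_univ _, hp,
      (isArborescence_parentArcs_iff hp).1 (Finset.mem_filter.1 hT).2⟩, rfl⟩
  · intro p _
    exact (prod_parentArcs r p D).symm

/-- The transposed in-degree Laplacian of `D`, with the row of `r` replaced by the unit vector
`e_r`. Its determinant is the cofactor of the Laplacian at `(r, r)`. -/
def groundedLaplacian (D : MultiDigraph V) (r : V) : Matrix V V ℝ :=
  fun v => if v = r then Pi.single r 1
    else ∑ u, (D u v : ℝ) • (Pi.single v 1 - Pi.single u 1 : V → ℝ)

theorem groundedLaplacian_apply_of_ne (D : MultiDigraph V) {r v : V} (hv : v ≠ r) (u : V) :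
    groundedLaplacian D r v u = (if v = u then (D.inDegree v : ℝ) else 0) - D u v := by
  simp only [groundedLaplacian, if_neg hv, Finset.sum_apply, Pi.smul_apply, Pi.sub_apply,
    smul_eq_mul, mul_sub, Finset.sum_sub_distrib, Pi.single_apply, inDegree, Nat.cast_sum]
  by_cases h : v = u
  · subst h; simp
  · simp [h, Ne.symm h]

/-- The matrix-tree theorem. By multilinearity in the rows the determinant is a weighted sum over
all parent functions `p`, and the determinant of `parentMatrix r p` is `1` or `0` according as
`p` is the parent function of a tree rooted at `r` or not. -/
theorem numArborescences_eq_det (D : MultiDigraph V) (r : V) :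
    (D.numArborescences r : ℝ) = (groundedLaplacian D r).det := by
  classical
  have hrow : groundedLaplacian D r = fun v => ∑ u,
      (if v = r then (if u = r then 1 else 0) else (D u v : ℝ)) •
        (if v = r then Pi.single r 1 else Pi.single v 1 - Pi.single u 1 : V → ℝ) := by
    funext v
    unfold groundedLaplacian
    split_ifs with h
    · simp
    · rfl
  have hdet : (groundedLaplacian D r).det = ∑ p : V → V,
      (∏ v, if v = r then (if p v = r then 1 else 0) else (D (p v) v : ℝ)) *
        (parentMatrix r p).det := by
    rw [hrow]
    change detRowAlternating.toMultilinearMap _ = _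
    rw [MultilinearMap.map_sum]
    refine Finset.sum_congr rfl fun p _ => ?_
    rw [MultilinearMap.map_smul_univ]
    rfl
  rw [hdet, numArborescences_eq_sum_parent, Nat.cast_sum, Finset.sum_filter]
  refine Finset.sum_congr rfl fun p _ => ?_
  rw [← Finset.mul_prod_erase _ _ (Finset.mem_univ r), if_pos rfl]
  have hprod : ∏ v ∈ Finset.univ.erase r,
      (if v = r then (if p v = r then 1 else 0) else (D (p v) v : ℝ)) =
      ∏ v ∈ Finset.univ.erase r, (D (p v) v : ℝ) :=
    Finset.prod_congr rfl fun v hv => if_neg (Finset.ne_of_mem_erase hv)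
  rw [hprod]
  by_cases hp : p r = r
  · by_cases hr : ∀ v, ∃ n, p^[n] v = r
    · rw [if_pos ⟨hp, hr⟩, det_parentMatrix_of_forall_reach hr]
      simp [hp]
    · rw [if_neg fun h => hr h.2, det_parentMatrix_of_not_reach hr]
      simp
  · simp [hp]

end MatrixTree

/-! ### Cofactors of a matrix with constant row and column sums -/

section Cofactor

variable {V : Type} [Fintype V] [DecidableEq V]

/-- Both sides are the cofactor of `B` at `(r, r)`. -/
theorem det_updateRow_single_eq_det_updateCol_single (B : Matrix V V ℝ) (r : V) :
    (B.updateRow r (Pi.single r 1)).det = (B.updateCol r (Pi.single r 1)).det := by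
  rw [← adjugate_apply, ← det_transpose (B.updateCol _ _), ← updateRow_transpose,
    ← adjugate_apply, ← adjugate_transpose, transpose_apply]

/-- If all row and column sums of `A` equal its size `n`, then `det A` is `n ^ 2` times the cofactor
at `(r, r)` of `A - J`, where `J` is the all-ones matrix. -/
theorem det_eq_card_sq_mul_det_updateRow (A : Matrix V V ℝ) (r : V)
    (hrow : ∀ v, ∑ u, A v u = Fintype.card V) (hcol : ∀ u, ∑ v, A v u = Fintype.card V) :
    A.det = (Fintype.card V : ℝ) ^ 2 *
      ((of fun v u => A v u - 1).updateRow r (Pi.single r 1)).det := by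
  set n : ℝ := (Fintype.card V : ℝ) with hn
  set B : Matrix V V ℝ := (of fun v u => A v u - 1).updateRow r 1 with hB
  -- Replace row `r` by the sum of all rows, subtract the resulting row of ones from the others, and
  -- replace column `r` by the sum of all columns.
  have h1 : A.det = n * (A.updateRow r 1).det := by
    have h := det_updateRow_sum A r 1
    rw [Pi.one_apply, one_smul] at h
    rw [← h, ← det_updateRow_smul]
    congr 2
    ext u
    refine (Finset.sum_apply u Finset.univ fun v => (1 : V → ℝ) v • A v).trans ?_
    simpa using hcol u
  have h2 : (A.updateRow r 1).det = B.det := by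
    refine det_eq_of_forall_row_eq_smul_add_const (fun v => if v = r then 0 else 1) r
      (if_pos rfl) fun v u => ?_
    by_cases hv : v = r
    · subst hv; simp [hB]
    · simp [hB, hv, updateRow_apply]
  have h3 : B.det = n * (B.updateCol r (Pi.single r 1)).det := by
    have h := det_updateCol_sum B r 1
    rw [Pi.one_apply, one_smul] at h
    rw [← h, ← det_updateCol_smul]
    congr 2
    ext v
    by_cases hv : v = r
    · subst hv; simp [hB, hn]
    · simp [hB, hv, updateRow_apply, Finset.sum_sub_distrib, hrow, hn]
  rw [h1, h2, h3, ← det_updateRow_single_eq_det_updateCol_single, hB, updateRow_idem]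
  ring

end Cofactor

/-! ### Eulerian rootings of the simplex -/

section Rootings

variable {k : ℕ}

/-- The sequence of pairs (edge, root) in which the `i`-th edge is the complement of `g i` and has
root `i`. -/
def permRooting (g : Equiv.Perm (Fin (k + 1))) (i : Fin (k + 1)) :
    Finset (Fin (k + 1)) × Fin (k + 1) :=
  ({g i}ᶜ, i)

theorem permRooting_injective :
    Function.Injective (permRooting : Equiv.Perm (Fin (k + 1)) → _) := by
  intro g h hgh
  ext1 i
  have := congrArg Prod.fst (congrFun hgh i)
  simpa [permRooting] using this

theorem map_compl_singleton_eq_simplexEdges (g : Equiv.Perm (Fin (k + 1))) :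
    Multiset.map (fun i => ({g i}ᶜ : Finset (Fin (k + 1)))) Finset.univ.val = simplexEdges k := by
  let e : Fin (k + 1) ↪ Finset (Fin (k + 1)) := ⟨fun i => {g i}ᶜ, fun i j h => by simpa using h⟩
  have : Finset.univ.map e = Finset.powersetCard k Finset.univ := by
    refine Finset.eq_of_subset_of_card_le (fun s hs => ?_) ?_
    · obtain ⟨i, -, rfl⟩ := Finset.mem_map.1 hs
      refine Finset.mem_powersetCard.2 ⟨Finset.subset_univ _, ?_⟩
      change ({g i}ᶜ : Finset (Fin (k + 1))).card = k
      rw [Finset.card_compl, Finset.card_singleton, Fintype.card_fin]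
      rfl
    · simp [Nat.choose_succ_self_right]
  exact congrArg Finset.val this

theorem exists_perm_of_map_eq_simplexEdges (e : Fin (k + 1) → Finset (Fin (k + 1)))
    (he : Multiset.map e Finset.univ.val = simplexEdges k) :
    ∃ g : Equiv.Perm (Fin (k + 1)), ∀ i, e i = {g i}ᶜ := by
  have hcard : ∀ i, ∃ w, e i = {w}ᶜ := by
    intro i
    have hi : e i ∈ simplexEdges k := he ▸ Multiset.mem_map_of_mem e (Finset.mem_univ i)
    have hi' := (Finset.mem_powersetCard.1 (Finset.mem_def.2 hi)).2
    obtain ⟨w, hw⟩ : ∃ w, (e i)ᶜ = {w} := by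
      rw [← Finset.card_eq_one, Finset.card_compl, hi', Fintype.card_fin]; omega
    exact ⟨w, by rw [← hw, compl_compl]⟩
  choose g hg using hcard
  have hinj : Function.Injective e := by
    have hnd : (Multiset.map e Finset.univ.val).Nodup := he ▸ Finset.nodup _
    intro i j hij
    exact Multiset.inj_on_of_nodup_map hnd i (Finset.mem_univ i) j (Finset.mem_univ j) hij
  have hgi : Function.Injective g := fun i j h => hinj (by rw [hg, hg, h])
  exact ⟨Equiv.ofBijective g (Finite.injective_iff_bijective.1 hgi), hg⟩

theorem card_filter_ne_and_ne {n : ℕ} {a b : Fin n} (h : a ≠ b) :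
    (Finset.univ.filter fun v => v ≠ a ∧ v ≠ b).card + 2 = n := by
  have : (Finset.univ.filter fun v => v ≠ a ∧ v ≠ b) = ({a, b} : Finset (Fin n))ᶜ := by
    ext; simp
  rw [this, Finset.card_compl, Finset.card_pair h, Fintype.card_fin]
  have := Finset.card_le_univ ({a, b} : Finset (Fin n))
  rw [Finset.card_pair h, Fintype.card_fin] at this
  omega

theorem outDegree_rootedDigraph_add (g : Equiv.Perm (Fin (k + 1)))
    (R : Fin (k + 1) → Finset (Fin (k + 1)) × Fin (k + 1)) (hg : ∀ i, (R i).1 = {g i}ᶜ)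
    (hR : ∀ i, (R i).2 ∈ (R i).1) (u : Fin (k + 1)) :
    (rootedDigraph R).outDegree u + (Finset.univ.filter fun i => (R i).2 = u).card =
      (Finset.univ.filter fun i => (R i).2 = u).card * k := by
  have key : (rootedDigraph R).outDegree u =
      ∑ i with (R i).2 = u, (Finset.univ.filter fun v => v ≠ g i ∧ v ≠ u).card := by
    unfold outDegree rootedDigraph
    rw [Finset.sum_comm, Finset.sum_filter]
    refine Finset.sum_congr rfl fun i _ => ?_
    rw [Finset.card_filter]
    by_cases h : (R i).2 = u
    · rw [if_pos h]
      refine Finset.sum_congr rfl fun v _ => ?_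
      simp [h, hg, ne_comm]
    · simp [h]
  rw [key, Finset.card_eq_sum_ones, ← Finset.sum_add_distrib, Finset.sum_mul]
  refine Finset.sum_congr rfl fun i hi => ?_
  have hne : g i ≠ u := by
    have h := hR i
    rw [(Finset.mem_filter.1 hi).2, hg] at h
    simpa [eq_comm] using h
  have := card_filter_ne_and_ne hne
  omega

theorem inDegree_rootedDigraph_add (g : Equiv.Perm (Fin (k + 1)))
    (R : Fin (k + 1) → Finset (Fin (k + 1)) × Fin (k + 1)) (hg : ∀ i, (R i).1 = {g i}ᶜ)
    (hR : ∀ i, (R i).2 ∈ (R i).1) (v : Fin (k + 1)) :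
    (rootedDigraph R).inDegree v + (Finset.univ.filter fun i => (R i).2 = v).card = k := by
  have key : (rootedDigraph R).inDegree v =
      (Finset.univ.filter fun i => g i ≠ v ∧ (R i).2 ≠ v).card := by
    unfold inDegree rootedDigraph
    rw [Finset.sum_comm, Finset.card_filter]
    refine Finset.sum_congr rfl fun i _ => ?_
    rw [Finset.sum_eq_single (R i).2 (fun u _ hu => if_neg fun h => hu h.1.symm) (by simp)]
    simp [hg, eq_comm]
  have hsplit : Finset.univ.filter (fun i => g i ≠ v) =
      (Finset.univ.filter fun i => g i ≠ v ∧ (R i).2 ≠ v) ∪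
        Finset.univ.filter fun i => (R i).2 = v := by
    ext i
    have h := hR i
    rw [hg, Finset.mem_compl, Finset.mem_singleton] at h
    simp only [Finset.mem_filter, Finset.mem_univ, true_and, Finset.mem_union]
    constructor
    · intro h1; by_cases h2 : (R i).2 = v <;> simp [h1, h2]
    · rintro (h1 | h1)
      · exact h1.1
      · rw [← h1]; exact Ne.symm h
  have hcard : (Finset.univ.filter fun i => g i ≠ v).card = k := by
    have : (Finset.univ.filter fun i => g i ≠ v) = {g.symm v}ᶜ := by
      ext i; simp [Equiv.eq_symm_apply]
    rw [this, Finset.card_compl, Finset.card_singleton, Fintype.card_fin]; rfl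
  rw [key, ← Finset.card_union_of_disjoint, ← hsplit, hcard]
  rw [Finset.disjoint_filter]
  exact fun i _ h1 h2 => h1.2 h2

/-- In an Eulerian rooting every vertex is the root of exactly one edge: if `v` is the root of `d`
edges, it has out-degree `d * (k - 1)` and in-degree `k - d`. As the roots are sorted, the `i`-th
root is then `i`. -/
theorem exists_eq_permRooting (hk : 1 ≤ k)
    (R : Fin (k + 1) → Finset (Fin (k + 1)) × Fin (k + 1))
    (h1 : Multiset.map (fun i => (R i).1) Finset.univ.val = simplexEdges k)
    (h2 : ∀ i, (R i).2 ∈ (R i).1) (h3 : Monotone fun i => (R i).2)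
    (h4 : (rootedDigraph R).IsEulerian) :
    ∃ g ∈ derangements (Fin (k + 1)), permRooting g = R := by
  obtain ⟨g, hg⟩ := exists_perm_of_map_eq_simplexEdges _ h1
  have hd : ∀ v, (Finset.univ.filter fun i => (R i).2 = v).card = 1 := by
    intro v
    have ho := outDegree_rootedDigraph_add g R hg h2 v
    have hi := inDegree_rootedDigraph_add g R hg h2 v
    rw [h4.1 v, ho] at hi
    exact Nat.eq_of_mul_eq_mul_right hk (hi.trans (one_mul k).symm)
  have hinj : Function.Injective fun i => (R i).2 := by
    intro i j hij
    obtain ⟨a, ha⟩ := Finset.card_eq_one.1 (hd (R j).2)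
    have hi : i ∈ ({a} : Finset _) := ha ▸ Finset.mem_filter.2 ⟨Finset.mem_univ i, hij⟩
    have hj : j ∈ ({a} : Finset _) := ha ▸ Finset.mem_filter.2 ⟨Finset.mem_univ j, rfl⟩
    rw [Finset.mem_singleton.1 hi, Finset.mem_singleton.1 hj]
  have hid : ∀ i, (R i).2 = i := by
    intro i
    have := Subsingleton.elim ((h3.strictMono_of_injective hinj).orderIsoOfSurjective _
      (Finite.surjective_of_injective hinj)) (OrderIso.refl _)
    exact congrArg (fun e : Fin (k + 1) ≃o Fin (k + 1) => e i) this
  refine ⟨g, fun i h => ?_, ?_⟩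
  · have := h2 i
    rw [hg, hid, h] at this
    simp at this
  · funext i
    exact Prod.ext (hg i).symm (hid i).symm

theorem rootedDigraph_permRooting (g : Equiv.Perm (Fin (k + 1))) (u v : Fin (k + 1)) :
    rootedDigraph (permRooting g) u v = if g u ≠ v ∧ u ≠ v then 1 else 0 := by
  unfold rootedDigraph
  rw [Finset.sum_eq_single u (fun i _ hi => if_neg fun h => hi h.1) (by simp)]
  simp [permRooting, eq_comm]

theorem snd_mem_fst_permRooting {g : Equiv.Perm (Fin (k + 1))}
    (hg : g ∈ derangements (Fin (k + 1))) (i : Fin (k + 1)) :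
    (permRooting g i).2 ∈ (permRooting g i).1 := by
  simpa [permRooting, eq_comm] using hg i

theorem card_filter_snd_permRooting (g : Equiv.Perm (Fin (k + 1))) (v : Fin (k + 1)) :
    (Finset.univ.filter fun i => (permRooting g i).2 = v).card = 1 := by
  rw [Finset.card_eq_one]
  refine ⟨v, Finset.ext fun i => ?_⟩
  rw [Finset.mem_filter, Finset.mem_singleton]
  exact ⟨fun h => h.2, fun h => ⟨Finset.mem_univ i, h⟩⟩

theorem inDegree_permRooting {g : Equiv.Perm (Fin (k + 1))}
    (hg : g ∈ derangements (Fin (k + 1))) (v : Fin (k + 1)) :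
    (rootedDigraph (permRooting g)).inDegree v + 1 = k := by
  have := inDegree_rootedDigraph_add g _ (fun _ => rfl) (snd_mem_fst_permRooting hg) v
  rwa [card_filter_snd_permRooting] at this

theorem isEulerian_permRooting {g : Equiv.Perm (Fin (k + 1))} (hk : 2 ≤ k)
    (hg : g ∈ derangements (Fin (k + 1))) : (rootedDigraph (permRooting g)).IsEulerian := by
  constructor
  · intro v
    have h := outDegree_rootedDigraph_add g _ (fun _ => rfl) (snd_mem_fst_permRooting hg) v
    rw [card_filter_snd_permRooting, one_mul] at h
    exact Nat.succ_injective ((inDegree_permRooting hg v).trans h.symm)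
  · intro u v _ _
    have hstep : ∀ a b, g a ≠ b → a ≠ b → 0 < rootedDigraph (permRooting g) a b := by
      intro a b h h'
      simp [rootedDigraph_permRooting, h, h']
    by_cases huv : u = v
    · subst huv; exact .refl
    by_cases hgu : g u = v
    · -- The arc from `u` to `g u` is missing, but any third vertex gives a path of length two.
      obtain ⟨w, hw⟩ : ∃ w, w ∉ ({u, v} : Finset (Fin (k + 1))) := by
        by_contra! h
        have := (Finset.card_le_card fun x _ => h x : Finset.univ.card ≤ _).trans
          Finset.card_le_two
        rw [Finset.card_univ, Fintype.card_fin] at this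
        omega
      simp only [Finset.mem_insert, Finset.mem_singleton, not_or] at hw
      have hgw : g w ≠ v := fun h => hw.1 (g.injective (h.trans hgu.symm))
      have h1 := hstep u w (fun h => hw.2 (h.symm.trans hgu)) (Ne.symm hw.1)
      exact .tail (.single h1) (hstep w v hgw hw.2)
    · exact .single (hstep u v hgu huv)

theorem card_simplexEdges (k : ℕ) : (simplexEdges k).card = k + 1 := by
  simp [simplexEdges, Nat.choose_succ_self_right]

open scoped Classical in
/-- The associated coefficient with the index type `Fin E.card` replaced by `Fin m`, for a given
value `m` of the number of edges. -/
theorem associatedCoeff_eq_of_card {V : Type} [Fintype V] [LinearOrder V] {m : ℕ}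
    (E : Multiset (Finset V)) (hE : E.card = m) (r : V) :
    associatedCoeff E r = ∑ R : Fin m → Finset V × V with
      (Multiset.map (fun i => (R i).1) Finset.univ.val = E ∧ (∀ i, (R i).2 ∈ (R i).1) ∧
        Monotone fun i => (R i).2) ∧ (rootedDigraph R).IsEulerian,
      ((rootedDigraph R).numArborescences r : ℝ) / ∏ v, ((rootedDigraph R).inDegree v : ℝ) := by
  subst hE
  unfold associatedCoeff IsRooting
  congr!

open scoped Classical in
theorem associatedCoeff_simplexEdges (hk : 2 ≤ k) (r : Fin (k + 1)) :
    associatedCoeff (simplexEdges k) r =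
      (∑ g : Equiv.Perm (Fin (k + 1)) with g ∈ derangements (Fin (k + 1)),
        ((rootedDigraph (permRooting g)).numArborescences r : ℝ)) / ((k : ℝ) - 1) ^ (k + 1) := by
  rw [associatedCoeff_eq_of_card _ (card_simplexEdges k), Finset.sum_div]
  symm
  refine Finset.sum_bij (fun g _ => permRooting g) ?_ (fun g _ h _ e => permRooting_injective e)
    ?_ ?_
  · intro g hg
    have hg := (Finset.mem_filter.1 hg).2
    exact Finset.mem_filter.2 ⟨Finset.mem_univ _, ⟨map_compl_singleton_eq_simplexEdges g,
      snd_mem_fst_permRooting hg, fun i j h => h⟩, isEulerian_permRooting hk hg⟩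
  · intro R hR
    obtain ⟨⟨h1, h2, h3⟩, h4⟩ := (Finset.mem_filter.1 hR).2
    obtain ⟨g, hg, rfl⟩ := exists_eq_permRooting (by omega) R h1 h2 h3 h4
    exact ⟨g, Finset.mem_filter.2 ⟨Finset.mem_univ _, hg⟩, rfl⟩
  · intro g hg
    have hdeg : ∀ v, ((rootedDigraph (permRooting g)).inDegree v : ℝ) = (k : ℝ) - 1 := by
      intro v
      exact eq_sub_of_add_eq (by exact_mod_cast inDegree_permRooting (Finset.mem_filter.1 hg).2 v)
    simp [hdeg]

/-- The arborescence count of an Eulerian rooting: the Laplacian of its digraph is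
`k I + P - J`, with `P` a permutation matrix and `J` the all-ones matrix. -/
theorem sq_mul_numArborescences_permRooting {g : Equiv.Perm (Fin (k + 1))}
    (hg : g ∈ derangements (Fin (k + 1))) (r : Fin (k + 1)) :
    ((k : ℝ) + 1) ^ 2 * (rootedDigraph (permRooting g)).numArborescences r =
      (scalar (Fin (k + 1)) (k : ℝ) + (g⁻¹).permMatrix ℝ).det := by
  have hA : ∀ v u, (scalar (Fin (k + 1)) (k : ℝ) + (g⁻¹).permMatrix ℝ) v u =
      (if v = u then (k : ℝ) else 0) + if g u = v then 1 else 0 := by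
    intro v u
    rw [Matrix.add_apply, scalar_apply, diagonal_apply]
    have h : g.symm v = u ↔ g u = v := by rw [Equiv.symm_apply_eq, eq_comm]
    simp [PEquiv.toMatrix_apply, Equiv.Perm.inv_def, h]
  rw [det_eq_card_sq_mul_det_updateRow _ r, numArborescences_eq_det]
  · rw [Fintype.card_fin]
    push_cast
    congr 2
    ext v u
    by_cases hv : v = r
    · subst hv; simp [groundedLaplacian]
    · rw [groundedLaplacian_apply_of_ne _ hv, updateRow_ne hv, of_apply, hA,
        rootedDigraph_permRooting]
      have hdeg : ((rootedDigraph (permRooting g)).inDegree v : ℝ) = (k : ℝ) - 1 :=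
        eq_sub_of_add_eq (by exact_mod_cast inDegree_permRooting hg v)
      rw [hdeg]
      have hu := hg u
      by_cases h1 : v = u
      · subst h1; simp [hu]
      · by_cases h2 : g u = v <;> simp [h1, h2, Ne.symm h1]
  · intro v
    simp only [hA, Finset.sum_add_distrib, ← Equiv.eq_symm_apply]
    simp
  · intro u
    simp only [hA, Finset.sum_add_distrib]
    simp

open scoped Classical in
theorem simplexConstant_eq (hk : 2 ≤ k) (r : Fin (k + 1)) :
    simplexConstant k r =
      (∑ g : Equiv.Perm (Fin (k + 1)) with g ∈ derangements (Fin (k + 1)),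
        (scalar (Fin (k + 1)) (k : ℝ) + (g⁻¹).permMatrix ℝ).det) /
          (((k : ℝ) - 1) * ((k : ℝ) + 1) ^ 2) := by
  have hk' : (2 : ℝ) ≤ k := by exact_mod_cast hk
  have h1 : (k : ℝ) - 1 ≠ 0 := by linarith
  have h2 : (k : ℝ) + 1 ≠ 0 := by linarith
  rw [simplexConstant, associatedCoeff_simplexEdges hk, ← Finset.sum_congr rfl fun g hg =>
    sq_mul_numArborescences_permRooting (Finset.mem_filter.1 hg).2 r, ← Finset.mul_sum]
  field_simp
  ring

end Rootings

/-! ### Determinants close to those of scalar matrices -/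

section Determinant

variable {V : Type} [Fintype V] [DecidableEq V]

open scoped Matrix.Norms.L2Operator in
theorem norm_le_one_of_mem_roots_charpoly_neg_permMatrix {σ : Equiv.Perm V} {μ : ℂ}
    (hμ : μ ∈ (-σ.permMatrix ℂ).charpoly.roots) : ‖μ‖ ≤ 1 := by
  have h1 : μ ∈ spectrum ℂ (-σ.permMatrix ℂ) :=
    mem_spectrum_iff_isRoot_charpoly.2 (Polynomial.isRoot_of_mem_roots hμ)
  have h2 : ‖(1 : Matrix V V ℂ)‖ ≤ 1 := by
    simpa using permMatrix_l2_opNorm_le (𝕜 := ℂ) (1 : Equiv.Perm V)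
  refine (spectrum.norm_le_norm_mul_of_mem h1).trans ?_
  rw [norm_neg]
  exact mul_le_one₀ (permMatrix_l2_opNorm_le σ) (norm_nonneg _) h2

/-- If a complex matrix of size `n` has trace zero and eigenvalues of norm at most one, then
`det (x - M) = x ^ n * exp w` with `w` of norm at most `n / x ^ 2`: the terms of
`∑ log (1 - μ / x)` that are linear in the eigenvalues `μ` cancel. -/
theorem exists_det_scalar_sub_eq_pow_mul_exp (M : Matrix V V ℂ) (hM : M.trace = 0)
    (hroots : ∀ μ ∈ M.charpoly.roots, ‖μ‖ ≤ 1) {x : ℝ} (hx : 2 ≤ x) :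
    ∃ w : ℂ, (scalar V (x : ℂ) - M).det = (x : ℂ) ^ Fintype.card V * Complex.exp w ∧
      ‖w‖ ≤ Fintype.card V / x ^ 2 := by
  have hx0 : 0 < x := by linarith
  have hxc : (x : ℂ) ≠ 0 := by exact_mod_cast hx0.ne'
  have hs : M.charpoly.Splits := IsAlgClosed.splits _
  have hcard : M.charpoly.roots.card = Fintype.card V := by
    rw [← hs.natDegree_eq_card_roots, charpoly_natDegree_eq_dim]
  have hsum : M.charpoly.roots.sum = 0 := by
    rw [← trace_eq_sum_roots_charpoly_of_splits hs, hM]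
  have hz : ∀ μ : ℂ, ‖μ‖ ≤ 1 → ‖-μ / x‖ ≤ 1 / x := by
    intro μ hμ
    rw [norm_div, norm_neg, Complex.norm_real, Real.norm_of_nonneg hx0.le]
    gcongr
  have hx2 : 1 / x ≤ 1 / 2 := by gcongr
  -- The induction runs over arbitrary multisets of numbers of norm at most one, so the linear terms
  -- are kept; they cancel only for the full multiset of eigenvalues.
  have key : ∀ s : Multiset ℂ, (∀ μ ∈ s, ‖μ‖ ≤ 1) → ∃ w : ℂ,
      (s.map fun μ => (x : ℂ) - μ).prod = (x : ℂ) ^ s.card * Complex.exp w ∧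
        ‖w + s.sum / x‖ ≤ s.card / x ^ 2 := by
    intro s
    induction s using Multiset.induction_on with
    | empty => exact fun _ => ⟨0, by simp, by simp⟩
    | cons μ s ih =>
      intro h
      obtain ⟨w, hw, hw'⟩ := ih fun ν hν => h ν (Multiset.mem_cons_of_mem hν)
      have hμ := hz μ (h μ (Multiset.mem_cons_self μ s))
      have hlt : ‖-μ / x‖ < 1 := by linarith
      refine ⟨Complex.log (1 + -μ / x) + w, ?_, ?_⟩
      · have hne : 1 + -μ / (x : ℂ) ≠ 0 := by
          intro h0
          rw [eq_neg_of_add_eq_zero_right h0] at hlt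
          simp at hlt
        rw [Multiset.map_cons, Multiset.prod_cons, hw, Multiset.card_cons, Complex.exp_add,
          Complex.exp_log hne]
        field_simp
        ring
      · have hlog : ‖Complex.log (1 + -μ / x) - -μ / x‖ ≤ 1 / x ^ 2 := by
          refine (Complex.norm_log_one_add_sub_self_le hlt).trans ?_
          have h1 : ‖-μ / x‖ ^ 2 ≤ 1 / x ^ 2 := by
            rw [← _root_.one_div_pow]; gcongr
          have h2 : (1 - ‖-μ / x‖)⁻¹ ≤ 2 := by
            rw [inv_le_comm₀ (by linarith) (by norm_num)]
            linarith
          have h3 : 0 ≤ (1 - ‖-μ / x‖)⁻¹ := inv_nonneg.2 (by linarith)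
          have h4 : (0 : ℝ) ≤ 1 / x ^ 2 := by positivity
          nlinarith [mul_le_mul h1 h2 h3 h4]
        have : Complex.log (1 + -μ / x) + w + (μ ::ₘ s).sum / x =
            (Complex.log (1 + -μ / x) - -μ / x) + (w + s.sum / x) := by
          rw [Multiset.sum_cons]; ring
        rw [this, Multiset.card_cons]
        refine (norm_add_le_of_le hlog hw').trans_eq ?_
        push_cast; ring
  obtain ⟨w, hw, hw'⟩ := key _ hroots
  refine ⟨w, ?_, ?_⟩
  · rw [← eval_charpoly, hs.eval_eq_prod_roots_of_monic (charpoly_monic M), hw, hcard]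
  · simpa [hsum, hcard] using hw'

/-- The permutation matrix of a derangement has trace zero and eigenvalues of norm at most one, so
`exists_det_scalar_sub_eq_pow_mul_exp` applies to its negative. -/
theorem exists_det_scalar_add_permMatrix_eq_pow_mul_exp {σ : Equiv.Perm V}
    (hσ : σ ∈ derangements V) {x : ℝ} (hx : 2 ≤ x) :
    ∃ w : ℂ, ((scalar V x + σ.permMatrix ℝ).det : ℂ) =
      (x : ℂ) ^ Fintype.card V * Complex.exp w ∧ ‖w‖ ≤ Fintype.card V / x ^ 2 := by
  obtain ⟨w, hw, hw'⟩ := exists_det_scalar_sub_eq_pow_mul_exp (-σ.permMatrix ℂ) (by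
    have : Function.fixedPoints σ = ∅ := Set.eq_empty_iff_forall_notMem.2 fun v hv => hσ v hv
    rw [trace_neg, trace_permutation, this]; simp)
    (fun μ hμ => norm_le_one_of_mem_roots_charpoly_neg_permMatrix hμ) hx
  refine ⟨w, ?_, hw'⟩
  rw [← hw, sub_neg_eq_add]
  refine (RingHom.map_det Complex.ofRealHom _).trans (congrArg det ?_)
  ext i j
  simp [diagonal_apply, apply_ite Complex.ofReal, PEquiv.toMatrix_apply]

theorem det_scalar_add_permMatrix_ne_zero {σ : Equiv.Perm V} (hσ : σ ∈ derangements V) {x : ℝ}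
    (hx : 2 ≤ x) : (scalar V x + σ.permMatrix ℝ).det ≠ 0 := by
  obtain ⟨w, hw, -⟩ := exists_det_scalar_add_permMatrix_eq_pow_mul_exp hσ hx
  intro h0
  have hx0 : (x : ℂ) ≠ 0 := by exact_mod_cast (by linarith : x ≠ 0)
  rw [h0, Complex.ofReal_zero] at hw
  exact mul_ne_zero (pow_ne_zero _ hx0) (Complex.exp_ne_zero w) hw.symm

theorem abs_det_scalar_add_permMatrix_sub_le {σ : Equiv.Perm V} (hσ : σ ∈ derangements V) {x : ℝ}
    (hx : 2 ≤ x) (hV : Fintype.card V ≤ x ^ 2) :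
    |(scalar V x + σ.permMatrix ℝ).det - x ^ Fintype.card V| ≤
      2 * (Fintype.card V / x ^ 2) * x ^ Fintype.card V := by
  have hx0 : 0 < x := by linarith
  obtain ⟨w, hw, hw'⟩ := exists_det_scalar_add_permMatrix_eq_pow_mul_exp hσ hx
  have hw1 : ‖w‖ ≤ 1 := hw'.trans (by rw [div_le_one (by positivity)]; exact hV)
  have hexp : ‖Complex.exp w - 1‖ ≤ 2 * (Fintype.card V / x ^ 2) :=
    (Complex.norm_exp_sub_one_le hw1).trans (by gcongr)
  rw [← Real.norm_eq_abs, ← Complex.norm_real, Complex.ofReal_sub, hw, Complex.ofReal_pow,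
    show (x : ℂ) ^ Fintype.card V * Complex.exp w - (x : ℂ) ^ Fintype.card V =
      (Complex.exp w - 1) * (x : ℂ) ^ Fintype.card V by ring, norm_mul, norm_pow,
    Complex.norm_real, Real.norm_of_nonneg hx0.le]
  gcongr

end Determinant

/-! ### Asymptotics of the simplex constant -/

theorem inv_mem_derangements {α : Type} {g : Equiv.Perm α} (hg : g ∈ derangements α) :
    g⁻¹ ∈ derangements α :=
  fun v hv => hg v (Equiv.Perm.inv_eq_iff_eq.1 hv).symm

/-- Each determinant in `simplexConstant_eq` is nonnegative as a multiple of an arborescence count,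
and nonzero because the eigenvalues of a permutation matrix have norm at most one. -/
theorem simplexConstant_pos {k : ℕ} (hk : 2 ≤ k) (r : Fin (k + 1)) : 0 < simplexConstant k r := by
  classical
  have hk' : (2 : ℝ) ≤ k := by exact_mod_cast hk
  rw [simplexConstant_eq hk]
  refine div_pos (Finset.sum_pos (fun g hg => ?_) ?_)
    (mul_pos (by linarith) (pow_pos (by linarith) 2))
  · have hg := (Finset.mem_filter.1 hg).2
    have hg' : g⁻¹ ∈ derangements (Fin (k + 1)) := inv_mem_derangements hg
    refine lt_of_le_of_ne ?_ (det_scalar_add_permMatrix_ne_zero hg' hk').symm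
    rw [← sq_mul_numArborescences_permRooting hg r]
    positivity
  · refine ⟨finRotate (k + 1), Finset.mem_filter.2 ⟨Finset.mem_univ _, fun i hi => ?_⟩⟩
    obtain ⟨m, rfl⟩ := Nat.exists_eq_add_of_le' hk
    rw [finRotate_apply] at hi
    exact one_ne_zero (add_eq_left.1 hi)

open scoped Classical in
/-- Up to a relative error `O(1 / k)`, each of the determinants in `simplexConstant_eq` is
`k ^ (k + 1)`, so their sum is governed by the number of derangements. -/
theorem abs_sum_det_div_sub_le {k : ℕ} (hk : 2 ≤ k) :
    |(∑ g : Equiv.Perm (Fin (k + 1)) with g ∈ derangements (Fin (k + 1)),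
        (scalar (Fin (k + 1)) (k : ℝ) + (g⁻¹).permMatrix ℝ).det) /
          ((k + 1)! * (k : ℝ) ^ (k + 1)) - numDerangements (k + 1) / (k + 1)!| ≤
      4 / (k : ℝ) := by
  have hk' : (2 : ℝ) ≤ k := by exact_mod_cast hk
  have hk0 : (0 : ℝ) < k := by linarith
  set s := (Finset.univ : Finset (Equiv.Perm (Fin (k + 1)))).filter
    (· ∈ derangements (Fin (k + 1)))
  have hs : (s.card : ℝ) = numDerangements (k + 1) := by
    have h := card_derangements_eq_numDerangements (Fin (k + 1))
    rw [Fintype.card_fin] at h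
    rw [← h, ← Fintype.card_coe s]
    exact congrArg _ (Fintype.card_congr (Equiv.subtypeEquivRight fun g => by simp [s]))
  have hs' : (s.card : ℝ) ≤ (k + 1)! := by
    have h := Finset.card_le_univ s
    rw [Fintype.card_perm, Fintype.card_fin] at h
    exact_mod_cast h
  have hfac : (0 : ℝ) < (k + 1)! := by positivity
  have hpow : (0 : ℝ) < (k : ℝ) ^ (k + 1) := by positivity
  have hbound : |(∑ g ∈ s, (scalar (Fin (k + 1)) (k : ℝ) + (g⁻¹).permMatrix ℝ).det) -
      s.card * (k : ℝ) ^ (k + 1)| ≤ s.card * (4 / k * (k : ℝ) ^ (k + 1)) := by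
    rw [← nsmul_eq_mul, ← nsmul_eq_mul, ← Finset.sum_const, ← Finset.sum_const,
      ← Finset.sum_sub_distrib]
    refine (Finset.abs_sum_le_sum_abs _ _).trans (Finset.sum_le_sum fun g hg => ?_)
    have hg := (Finset.mem_filter.1 hg).2
    have hg' : g⁻¹ ∈ derangements (Fin (k + 1)) := inv_mem_derangements hg
    have h := abs_det_scalar_add_permMatrix_sub_le hg' hk' (by
      rw [Fintype.card_fin]; push_cast; nlinarith)
    rw [Fintype.card_fin] at h
    refine h.trans (mul_le_mul_of_nonneg_right ?_ hpow.le)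
    rw [← mul_div_assoc, div_le_div_iff₀ (by positivity) hk0]
    push_cast
    nlinarith
  rw [← hs, div_sub_div _ _ (by positivity) hfac.ne', abs_div,
    abs_of_pos (by positivity : (0 : ℝ) < (k + 1)! * (k : ℝ) ^ (k + 1) * (k + 1)!),
    div_le_iff₀ (by positivity)]
  calc _ = |(∑ g ∈ s, (scalar (Fin (k + 1)) (k : ℝ) + (g⁻¹).permMatrix ℝ).det) -
        s.card * (k : ℝ) ^ (k + 1)| * (k + 1)! := by
        rw [← abs_of_pos hfac, ← abs_mul, abs_of_pos hfac]
        congr 1; ring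
    _ ≤ s.card * (4 / k * (k : ℝ) ^ (k + 1)) * (k + 1)! := by gcongr
    _ ≤ (k + 1)! * (4 / k * (k : ℝ) ^ (k + 1)) * (k + 1)! := by gcongr
    _ = _ := by ring

theorem simplexConstant_isEquivalent (r : (k : ℕ) → Fin (k + 1)) :
    (fun k : ℕ => simplexConstant k (r k)) ~[atTop]
      fun k : ℕ => ((k + 1)! : ℝ) * (k : ℝ) ^ (k + 1) / (Real.exp 1 * (k : ℝ) ^ 3) := by
  classical
  rw [isEquivalent_iff_tendsto_one]
  swap
  · filter_upwards [eventually_ge_atTop 1] with k hk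
    have : (0 : ℝ) < k := by exact_mod_cast hk
    positivity
  have h1 : Tendsto (fun k : ℕ =>
      (∑ g : Equiv.Perm (Fin (k + 1)) with g ∈ derangements (Fin (k + 1)),
        (scalar (Fin (k + 1)) (k : ℝ) + (g⁻¹).permMatrix ℝ).det) /
          ((k + 1)! * (k : ℝ) ^ (k + 1))) atTop (𝓝 (Real.exp (-1))) := by
    have h2 : Tendsto (fun k : ℕ => (numDerangements (k + 1) : ℝ) / (k + 1)!) atTop
        (𝓝 (Real.exp (-1))) := numDerangements_tendsto_inv_e.comp (tendsto_add_atTop_nat 1)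
    refine (tendsto_iff_of_dist ?_).2 h2
    refine squeeze_zero' (Eventually.of_forall fun _ => dist_nonneg) ?_
      (tendsto_const_div_atTop_nhds_zero_nat 4)
    filter_upwards [eventually_ge_atTop 2] with k hk
    exact abs_sum_det_div_sub_le hk
  have h3 : Tendsto (fun k : ℕ => (1 - 1 / (k : ℝ)) * (1 + 1 / (k : ℝ)) ^ 2) atTop
      (𝓝 ((1 - 0) * (1 + 0) ^ 2)) := by
    have := tendsto_one_div_atTop_nhds_zero_nat (𝕜 := ℝ)
    exact (this.const_sub 1).mul ((this.const_add 1).pow 2)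
  have h4 := (h1.mul_const (Real.exp 1)).div h3 (by norm_num)
  have h5 : Real.exp (-1) * Real.exp 1 / ((1 - 0) * (1 + 0) ^ 2) = 1 := by
    rw [← Real.exp_add]; norm_num
  rw [h5] at h4
  refine h4.congr' ?_
  filter_upwards [eventually_ge_atTop 2] with k hk
  have hk' : (2 : ℝ) ≤ k := by exact_mod_cast hk
  have hk0 : (k : ℝ) ≠ 0 := by linarith
  have hk1 : (k : ℝ) - 1 ≠ 0 := by linarith
  have hk2 : (k : ℝ) + 1 ≠ 0 := by linarith
  simp only [Pi.div_apply]
  rw [simplexConstant_eq hk]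
  have hfac : ((k + 1)! : ℝ) ≠ 0 := by positivity
  have h6 : (1 - 1 / (k : ℝ)) * (1 + 1 / (k : ℝ)) ^ 2 =
      (((k : ℝ) - 1) * ((k : ℝ) + 1) ^ 2) / (k : ℝ) ^ 3 := by
    field_simp
  rw [h6]
  field_simp

/-- If `C` is asymptotic to `(k + 1)! * k ^ (k + 1) / (e * k ^ 3)`, then
`log C = 2 * k * log k + O(k)`, because `log k! = k * log k + O(k)`. -/
theorem tendsto_log_div_sub_two {C : ℕ → ℝ} (hC : ∀ k, 2 ≤ k → 0 < C k)
    (h : C ~[atTop] fun k : ℕ => ((k + 1)! : ℝ) * (k : ℝ) ^ (k + 1) / (Real.exp 1 * (k : ℝ) ^ 3)) :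
    Tendsto (fun k : ℕ => Real.log (C k) / (k * Real.log k) - 2) atTop (𝓝 0) := by
  have hratio := ((isEquivalent_iff_tendsto_one (by
    filter_upwards [eventually_ge_atTop 1] with k hk
    have : (0 : ℝ) < k := by exact_mod_cast hk
    positivity)).1 h).log one_ne_zero
  rw [Real.log_one] at hratio
  have hlog : Tendsto (fun k : ℕ => Real.log k) atTop atTop :=
    Real.tendsto_log_atTop.comp tendsto_natCast_atTop_atTop
  refine squeeze_zero_norm' ?_ (hlog.const_div_atTop 6)
  filter_upwards [eventually_ge_atTop 2, hlog.eventually_ge_atTop 1,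
    hratio.eventually (Metric.closedBall_mem_nhds 0 one_pos)] with k hk hL hb
  have hk1 : (1 : ℝ) ≤ k := by exact_mod_cast (by omega : 1 ≤ k)
  have hk0 : (0 : ℝ) < k := by linarith
  have hL0 : 0 < Real.log k := by linarith
  have hfac : (0 : ℝ) < k ! := by positivity
  rw [dist_zero_right, Real.norm_eq_abs, Pi.div_apply,
    Real.log_div (hC k hk).ne' (by positivity), Real.log_div (by positivity) (by positivity),
    Real.log_mul (by positivity) (by positivity), Real.log_mul (by positivity) (by positivity),
    Real.log_exp, Real.log_pow, Real.log_pow, Nat.factorial_succ, Nat.cast_mul,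
    Real.log_mul (by positivity) (by positivity), abs_le] at hb
  have hlow : k * Real.log k - k ≤ Real.log k ! := by
    have h1 := Stirling.le_log_factorial_stirling (n := k) (by omega)
    have h2 : 0 ≤ Real.log (2 * Real.pi) := Real.log_nonneg (by linarith [Real.pi_gt_three])
    linarith
  have hup : Real.log k ! ≤ k * Real.log k := by
    rw [← Real.log_pow]
    exact Real.log_le_log hfac (by exact_mod_cast Nat.factorial_le_pow k)
  have hsucc : Real.log ((k + 1 : ℕ) : ℝ) ≤ k := by
    have := Real.log_le_sub_one_of_pos (by positivity : (0 : ℝ) < (k + 1 : ℕ))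
    push_cast at this ⊢
    linarith
  have hsucc0 : 0 ≤ Real.log ((k + 1 : ℕ) : ℝ) := Real.log_natCast_nonneg _
  have hLk : Real.log k ≤ k := Real.log_le_self hk0.le
  have hmain : |Real.log (C k) - 2 * (k * Real.log k)| ≤ 6 * k := by
    obtain ⟨hb1, hb2⟩ := hb
    push_cast at hb1 hb2 hsucc hsucc0
    rw [abs_le]
    constructor <;> linarith
  have hpos : 0 < k * Real.log k := by positivity
  rw [Real.norm_eq_abs, show Real.log (C k) / (k * Real.log k) - 2 =
    (Real.log (C k) - 2 * (k * Real.log k)) / (k * Real.log k) by field_simp,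
    abs_div, abs_of_pos hpos, div_le_div_iff₀ hpos hL0]
  nlinarith

theorem theoremT (r : (k : ℕ) → Fin (k + 1)) :
    ((fun k : ℕ => SimplexConstant.simplexConstant k (r k)) ~[atTop]
      fun k : ℕ => ((k + 1)! : ℝ) * (k : ℝ) ^ (k + 1) / (Real.exp 1 * (k : ℝ) ^ 3)) ∧
    ∃ ε : ℕ → ℝ, Tendsto ε atTop (𝓝 0) ∧
      ∀ k : ℕ, 2 ≤ k →
        SimplexConstant.simplexConstant k (r k) =
          Real.exp ((2 + ε k) * ((k : ℝ) * Real.log (k : ℝ))) := by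
  refine ⟨simplexConstant_isEquivalent r, _,
    tendsto_log_div_sub_two (fun k hk => simplexConstant_pos hk (r k))
      (simplexConstant_isEquivalent r), fun k hk => ?_⟩
  have hk' : (1 : ℝ) < k := by exact_mod_cast (by omega : 1 < k)
  have hL : Real.log k ≠ 0 := (Real.log_pos hk').ne'
  have hk0 : (k : ℝ) ≠ 0 := by linarith
  rw [add_sub_cancel, div_mul_cancel₀ _ (mul_ne_zero hk0 hL),
    Real.exp_log (simplexConstant_pos hk (r k))]
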